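/- Let $F \neq \mathbb{Q}$ be a number field of degree $d$ with ring of integers $\mathcal{O}_F$, discriminant $D_F$ and set of field embeddings $\Sigma = \{\sigma : F \to \mathbb{C}\}$. Let $F_{\mathbb{R}} = \mathbb{R} \otimes_{\mathbb{Q}} F$, identified with the real algebra of all $(x_\sigma) \in \mathbb{C}^\Sigma$ such that $x_{\overline{\sigma}} = \overline{x_\sigma}$ for all $\sigma$, and let $x \mapsto \overline{x}$ be the componentwise complex conjugation on $F_{\mathbb{R}}$. Let $L$ be a free $\mathcal{O}_F$-module of finite rank $N$, and put $V = F \otimes_{\mathcal{O}_F} L$ and $V_{\mathbb{R}} = \mathbb{R} \otimes_{\mathbb{Q}} V = F_{\mathbb{R}} \otimes_F V$. Let $h = (h_\sigma)_{\sigma\in\Sigma} : V_{\mathbb{R}} \times V_{\mathbb{R}} \to F_{\mathbb{R}}$ be a positive definite hermitian form: it is biadditive, $F_{\mathbb{R}}$-linear in the first variable, satisfies $h(y,x) = \overline{h(x,y)}$, and for every $x \in V_{\mathbb{R}}$ one has $h_\sigma(x,x) \geq 0$ for all $\sigma \in \Sigma$, with $h(x,x) = 0$ only if $x = 0$. Put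 $\|x\|_h = \big(\sum_{\sigma \in \Sigma} h_\sigma(x,x)\big)^{1/2}$. Suppose that there exist $e_1, \dots, e_N \in L$ that span $V$ over $F$ and satisfy $\|e_i\|_h \leq 1$ for $i = 1, \dots, N$. Then there exist a decomposition $L = L_1 \oplus \cdots \oplus L_N$ into $\mathcal{O}_F$-submodules of rank one and elements $f_i \in L_i$ such that, for every $i = 1, \dots, N$, the quotient $L_i / f_i \mathcal{O}_F$ is finite and $$|L_i / f_i \mathcal{O}_F| \leq C_1 C_3^d, \qquad \|f_i\|_h \leq i\, C_1 C_2 C_3^d,$$ where $C_1 = |D_F|^{1/2}$, $C_2 = \frac{d}{2} |D_F|^{1/d}$ and $C_3 = \sqrt{d}\, |D_F|^{1/d}$. -/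

import Mathlib

open scoped TensorProduct NumberField

noncomputable section

namespace HermitianLattice

variable (F : Type*) [Field F] [NumberField F]

/-- The real algebra `F_ℝ = ℝ ⊗_ℚ F`, in its standard realization as the set of those
`(x_σ) ∈ ℂ^Σ` (with `Σ` the set of all embeddings `σ : F → ℂ`) that are fixed by the involution
`(x_σ) ↦ (conj x_{conj σ})`. Its `star` is the componentwise complex conjugation. -/
def realPoints : StarSubalgebra ℝ ((F →+* ℂ) → ℂ) where
  carrier := {x | ∀ σ : F →+* ℂ, x (NumberField.ComplexEmbedding.conjugate σ) = star (x σ)}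
  mul_mem' := by
    intro x y hx hy σ
    simp only [Pi.mul_apply, hx σ, hy σ, star_mul']
  add_mem' := by
    intro x y hx hy σ
    simp only [Pi.add_apply, hx σ, hy σ, star_add]
  algebraMap_mem' := by
    intro r σ
    simp [Pi.algebraMap_apply]
  star_mem' := by
    intro x hx σ
    simp only [Pi.star_apply, hx σ]

/-- `F_ℝ` as a commutative ring with involution. -/
abbrev FR : Type _ := ↥(realPoints F)

/-- The canonical embedding `a ↦ (σ(a))_σ` of `F` into `F_ℝ`. -/
def toFR : F →+* FR F :=
  (NumberField.canonicalEmbedding F).codRestrict (realPoints F) (by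
    intro a σ
    rfl)

instance : Algebra F (FR F) := (toFR F).toAlgebra

variable (L : Type*) [AddCommGroup L] [Module (𝓞 F) L]

/-- `V = F ⊗_{O_F} L`. -/
abbrev V : Type _ := F ⊗[𝓞 F] L

/-- The `F_ℝ`-module `V_ℝ = ℝ ⊗_ℚ V = F_ℝ ⊗_F V`. -/
abbrev VR : Type _ := FR F ⊗[F] V F L

variable {L}

/-- The canonical map `L → V`. -/
def toV (x : L) : V F L := (1 : F) ⊗ₜ[𝓞 F] x

/-- The canonical map `L → V_ℝ`. -/
def toVR (x : L) : VR F L := (1 : FR F) ⊗ₜ[F] toV F x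

variable (L)

/-- Maps `V_ℝ × V_ℝ → F_ℝ` that are `F_ℝ`-linear in the first variable and conjugate-linear in
the second one. -/
abbrev SesqForm : Type _ := VR F L →ₗ[FR F] VR F L →ₛₗ[starRingEnd (FR F)] FR F

variable {F L}

/-- The component `h_σ : V_ℝ × V_ℝ → ℂ` of `h`. -/
def SesqForm.comp (h : SesqForm F L) (σ : F →+* ℂ) (x y : VR F L) : ℂ :=
  (h x y : (F →+* ℂ) → ℂ) σ

/-- `h` is hermitian: `h(y, x)` is the conjugate of `h(x, y)`. -/
def SesqForm.IsHermitian (h : SesqForm F L) : Prop :=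
  ∀ x y, h y x = star (h x y)

/-- `h` is positive definite. A nonzero `x ∈ V_ℝ` may vanish at some of the embeddings, so
this says that all components of `h(x, x)` are nonnegative and do not all vanish if `x ≠ 0`; by
`F_ℝ`-linearity it means that `h_σ` is positive definite on `V ⊗_{F,σ} ℂ` (on `V ⊗_{F,σ} ℝ`
if `σ` is real) for each `σ`. -/
def SesqForm.IsPosDef (h : SesqForm F L) : Prop :=
  (∀ x σ, 0 ≤ (h.comp σ x x).re) ∧ ∀ x, h x x = 0 → x = 0

/-- The real quadratic form `q_h(x) = Tr(h(x, x)) = ∑_σ h_σ(x, x)`; the components are real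
for hermitian `h`. -/
def SesqForm.quad (h : SesqForm F L) (x : VR F L) : ℝ :=
  ∑ σ : F →+* ℂ, (h.comp σ x x).re

/-- The norm `‖x‖_h = q_h(x)^{1/2}`. -/
def SesqForm.norm (h : SesqForm F L) (x : VR F L) : ℝ := √(h.quad x)

variable (F)

/-- `C₁ = |D_F|^{1/2}`. -/
def C₁ : ℝ := √(|(NumberField.discr F : ℝ)|)

/-- `C₂ = (d/2) |D_F|^{1/d}` with `d = [F : ℚ]`. -/
def C₂ : ℝ := (Module.finrank ℚ F : ℝ) / 2 *
  |(NumberField.discr F : ℝ)| ^ (1 / (Module.finrank ℚ F : ℝ))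

/-- `C₃ = √d |D_F|^{1/d}` with `d = [F : ℚ]`. -/
def C₃ : ℝ := √(Module.finrank ℚ F : ℝ) *
  |(NumberField.discr F : ℝ)| ^ (1 / (Module.finrank ℚ F : ℝ))

end HermitianLattice

end

/-! Expand vectors of `L` in the basis `e` and filter `L` by the last nonzero coordinate. The `i`-th
coordinate maps the `i`-th step onto a fractional ideal, isomorphic to an ideal `A` of `𝓞 F`; as `A`
is projective, the step splits, and the images of the sections are the rank one summands.

Minkowski's theorem (`exists_mem_ideal_small`) gives a small `a` in `A` with index `m ≤ 2√|D|`, and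
`f i` is its image under a section. The section may be altered by maps into the span of the earlier
`e j`, which moves the lower coordinates of `f i` by arbitrary elements of `m 𝓞 F`. The covering
radius bound `√|D|` (`infDist_integerLattice_lt`) then makes these coordinates at most `m√|D| ≤
2|D|` at every place. The triangle inequality and `2|D| ≤ C₃ ^ d`, valid for `d ≥ 2`, finish. -/

namespace NumberField

open NumberField InfinitePlace mixedEmbedding Module

/-! ### Geometry of numbers: small elements of ideals and the covering radius. -/

section

variable (K : Type*) [Field K] [NumberField K]

open scoped Classical in
open MeasureTheory ENNReal in
/-- Measured against the unit ball of the sup norm, the covolume of `𝓞 K` is at most `√|D_K|`. -/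
theorem volume_latticeBasis_mul_two_pow_le :
    volume (ZSpan.fundamentalDomain (latticeBasis K)) * (2 : ℝ≥0∞) ^ finrank ℚ K ≤
      (convexBodyLTFactor K : ℝ≥0∞) * (NNReal.sqrt ‖discr K‖₊ : ℝ≥0∞) := by
  rw [volume_fundamentalDomain_latticeBasis, ← card_add_two_mul_card_eq_rank,
    convexBodyLTFactor, pow_add, pow_mul]
  have h : (2 : ℝ≥0∞)⁻¹ ^ nrComplexPlaces K * (2 ^ 2) ^ nrComplexPlaces K =
      2 ^ nrComplexPlaces K := by
    rw [← mul_pow, pow_two, ← mul_assoc, ENNReal.inv_mul_cancel (by simp) (by simp), one_mul]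
  -- Each complex place contributes 2 on the left and `π` on the right.
  have hpi : (2 : ℝ≥0∞) ≤ (NNReal.pi : ℝ≥0∞) := by
    exact_mod_cast (show (2 : NNReal) ≤ NNReal.pi from Real.two_le_pi)
  calc _ = (2 : ℝ≥0∞) ^ nrRealPlaces K *
        ((2 : ℝ≥0∞)⁻¹ ^ nrComplexPlaces K * (2 ^ 2) ^ nrComplexPlaces K) *
          (NNReal.sqrt ‖discr K‖₊ : ℝ≥0∞) := by ring
    _ ≤ _ := by
      rw [h]
      push_cast
      gcongr

theorem one_le_abs_discr : (1 : ℝ) ≤ |(discr K : ℝ)| := by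
  rw [← Int.cast_abs]
  exact_mod_cast Int.one_le_abs (discr_ne_zero K)

theorem one_le_sqrt_abs_discr : (1 : ℝ) ≤ √|(discr K : ℝ)| :=
  Real.one_le_sqrt.mpr (one_le_abs_discr K)

theorem coe_sqrt_nnnorm_discr :
    ((NNReal.sqrt ‖discr K‖₊ : NNReal) : ℝ) = √|(discr K : ℝ)| := by
  rw [Real.coe_sqrt, coe_nnnorm, Int.norm_eq_abs]

variable {K}

open MeasureTheory ENNReal in
/-- Minkowski's theorem for an ideal `A`, with control of the size relative to a given element
`n` of `A`. -/
theorem exists_mem_ideal_small (A : Ideal (𝓞 K)) (n : 𝓞 K) (hn : n ≠ 0) (hnA : n ∈ A) :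
    ∃ a ∈ A, a ≠ 0 ∧
      (∀ w : InfinitePlace K, w (a : K) ≤ 2 * √|(discr K : ℝ)| * w (n : K)) ∧
      ((Ideal.absNorm (Ideal.span {a}) : ℕ) : ℝ) ≤ 2 * √|(discr K : ℝ)| * Ideal.absNorm A := by
  classical
  have hd : finrank ℚ K ≠ 0 := finrank_pos.ne'
  have hA : A ≠ ⊥ := fun h => hn (by simpa [h] using hnA)
  have hN (a : 𝓞 K) : ((Ideal.absNorm (Ideal.span {a}) : ℕ) : ℝ) =
      ∏ w : InfinitePlace K, w (a : K) ^ w.mult := by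
    rw [prod_eq_abs_norm, Ideal.absNorm_span_singleton, ← Algebra.coe_norm_int, Nat.cast_natAbs]
    simp
  set S : ℝ := 2 * √|(discr K : ℝ)| with hS
  have hS1 : 1 ≤ S := by linarith [one_le_sqrt_abs_discr K]
  have hAn : (Ideal.absNorm A : ℝ) ≤ Ideal.absNorm (Ideal.span {n}) := by
    exact_mod_cast Nat.le_of_dvd
      (Nat.pos_of_ne_zero (by simpa [Ideal.absNorm_eq_zero_iff] using hn))
      (Ideal.absNorm_dvd_absNorm_of_le ((Ideal.span_singleton_le_iff_mem A).mpr hnA))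
  have hApos : (0 : ℝ) < Ideal.absNorm A := by
    exact_mod_cast Nat.pos_of_ne_zero (by simpa [Ideal.absNorm_eq_zero_iff] using hA)
  have hnpos := hApos.trans_le hAn
  -- The box `|x_w| < c * w n` is scaled so that its volume is twice what Minkowski's theorem
  -- requires up to replacing `π` by 2; the factor 2 in `S` makes the inequality strict.
  set c : ℝ := (S * Ideal.absNorm A / Ideal.absNorm (Ideal.span {n})) ^ ((finrank ℚ K : ℝ)⁻¹)
    with hc
  have hc0 : 0 ≤ c := by positivity
  have hcd : c ^ finrank ℚ K = S * Ideal.absNorm A / Ideal.absNorm (Ideal.span {n}) :=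
    Real.rpow_inv_natCast_pow (by positivity) hd
  -- If `c ≥ 1` then `c ≤ c ^ d ≤ S`, since `n ∈ A` forces the norm of `A` to be at most that of
  -- `n`.
  have hcS : c ≤ S := by
    rcases le_total c 1 with h | h
    · exact h.trans hS1
    · refine (le_self_pow₀ h hd).trans ?_
      rw [hcd, div_le_iff₀ hnpos]
      gcongr
  have hprod : ∏ w : InfinitePlace K, (c * w (n : K)) ^ w.mult = S * Ideal.absNorm A := by
    simp_rw [mul_pow]
    rw [Finset.prod_mul_distrib, ← hN, Finset.prod_pow_eq_pow_sum, sum_mult_eq, hcd]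
    field_simp
  let f : InfinitePlace K → NNReal := fun w => ⟨c * w (n : K), by positivity⟩
  have hfprod : ((∏ w, f w ^ w.mult : NNReal) : ℝ) = S * Ideal.absNorm A := by
    push_cast
    exact hprod
  let I : (FractionalIdeal (nonZeroDivisors (𝓞 K)) K)ˣ :=
    Units.mk0 (A : FractionalIdeal (nonZeroDivisors (𝓞 K)) K)
      (FractionalIdeal.coeIdeal_ne_zero.mpr hA)
  have hlt : minkowskiBound K I < volume (convexBodyLT K f) := by
    rw [minkowskiBound, volume_fundamentalDomain_fractionalIdealLatticeBasis,
      convexBodyLT_volume, mixedEmbedding.finrank, mul_assoc]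
    have h1 : ENNReal.ofReal (FractionalIdeal.absNorm I.1) = (Ideal.absNorm A : ℝ≥0∞) := by
      simp [I, FractionalIdeal.coeIdeal_absNorm]
    have h2 : ((∏ w, f w ^ w.mult : NNReal) : ℝ≥0∞) =
        2 * ((NNReal.sqrt ‖discr K‖₊ : ℝ≥0∞) * (Ideal.absNorm A : ℝ≥0∞)) := by
      have : (∏ w, f w ^ w.mult : NNReal) =
          2 * (NNReal.sqrt ‖discr K‖₊ * (Ideal.absNorm A : NNReal)) := by
        apply NNReal.coe_injective
        rw [hfprod, NNReal.coe_mul, NNReal.coe_mul, coe_sqrt_nnnorm_discr, hS]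
        simp [mul_assoc]
      rw [this]
      push_cast
      rfl
    rw [h1, h2]
    set X : ℝ≥0∞ := (convexBodyLTFactor K : ℝ≥0∞) *
      ((NNReal.sqrt ‖discr K‖₊ : ℝ≥0∞) * (Ideal.absNorm A : ℝ≥0∞)) with hX
    have hX0 : X ≠ 0 := by
      have h3 : (Ideal.absNorm A : ℝ≥0∞) ≠ 0 := by exact_mod_cast hApos.ne'
      have h4 : (NNReal.sqrt ‖discr K‖₊ : ℝ≥0∞) ≠ 0 := by simp [discr_ne_zero]
      have h5 : (convexBodyLTFactor K : ℝ≥0∞) ≠ 0 := by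
        exact_mod_cast convexBodyLTFactor_ne_zero K
      exact mul_ne_zero h5 (mul_ne_zero h4 h3)
    have hXtop : X ≠ ⊤ :=
      ENNReal.mul_ne_top ENNReal.coe_ne_top
        (ENNReal.mul_ne_top ENNReal.coe_ne_top (ENNReal.natCast_ne_top _))
    calc _ ≤ (Ideal.absNorm A : ℝ≥0∞) *
          ((convexBodyLTFactor K : ℝ≥0∞) * (NNReal.sqrt ‖discr K‖₊ : ℝ≥0∞)) := by
          exact mul_le_mul' le_rfl (volume_latticeBasis_mul_two_pow_le K)
      _ = X := by rw [hX]; ring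
      _ < X + X := ENNReal.lt_add_right hXtop hX0
      _ = _ := by rw [hX]; ring
  obtain ⟨x, hxI, hx0, hxf⟩ := exists_ne_zero_mem_ideal_lt K I hlt
  obtain ⟨a, haA, rfl⟩ := (FractionalIdeal.mem_coeIdeal _).mp hxI
  refine ⟨a, haA, fun h => hx0 (by simp [h]), fun w => ?_, ?_⟩
  · refine (hxf w).le.trans ?_
    change c * w (n : K) ≤ _
    gcongr
  · rw [hN, ← hprod]
    refine Finset.prod_le_prod (fun w _ => by positivity) fun w _ => ?_
    exact pow_le_pow_left₀ (by positivity) (hxf w).le _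

open scoped Classical in
theorem normAtPlace_le_norm (x : mixedSpace K) (w : InfinitePlace K) : normAtPlace w x ≤ ‖x‖ := by
  rw [norm_eq_sup'_normAtPlace]
  exact Finset.le_sup' (fun w => normAtPlace w x) (Finset.mem_univ w)

open scoped Classical in
theorem one_le_norm_of_mem_integerLattice {x : mixedSpace K}
    (hx : x ∈ mixedEmbedding.integerLattice K) (hx0 : x ≠ 0) : 1 ≤ ‖x‖ := by
  obtain ⟨b, rfl⟩ := LinearMap.mem_range.mp hx
  have hb : b ≠ 0 := by rintro rfl; simp at hx0
  -- A nonzero integer has norm at least 1 in absolute value, so its absolute values cannot all be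
  -- below 1.
  obtain ⟨w, hw⟩ : ∃ w : InfinitePlace K, 1 ≤ w (b : K) := by
    by_contra! h
    obtain ⟨w₀⟩ : Nonempty (InfinitePlace K) := inferInstance
    exact (h w₀).not_ge (one_le_of_lt_one hb fun z _ => h z)
  refine hw.trans ?_
  rw [← normAtPlace_apply]
  exact normAtPlace_le_norm _ w

open scoped Classical in
open MeasureTheory ENNReal in
theorem volume_ball_half (x : mixedSpace K) :
    volume (Metric.ball x (1 / 2)) * 2 ^ finrank ℚ K = (convexBodyLTFactor K : ℝ≥0∞) := by
  have h : Metric.ball (0 : mixedSpace K) (1 / 2) = convexBodyLT K fun _ => 1 / 2 := by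
    rw [convexBodyLT, ← Prod.mk_zero_zero, ← ball_prod_same, ball_pi _ (by norm_num),
      ball_pi _ (by norm_num)]
    simp
  rw [Measure.addHaar_ball_center, h, convexBodyLT_volume, Finset.prod_pow_eq_pow_sum, sum_mult_eq,
    mul_assoc]
  push_cast
  rw [← mul_pow, one_div,
    ENNReal.inv_mul_cancel (by simp) (by simp), one_pow, mul_one]

open scoped Classical in
open MeasureTheory ENNReal in
/-- The covering radius of the lattice `𝓞 K` for the sup norm is less than `√|D_K|`: otherwise a
path that leaves the lattice meets more than `√|D_K|` disjoint balls of radius `1 / 2` which embed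
disjointly modulo the lattice. -/
theorem infDist_integerLattice_lt (y : mixedSpace K) :
    Metric.infDist y (mixedEmbedding.integerLattice K : Set (mixedSpace K)) <
      √|(discr K : ℝ)| := by
  set Λ : Set (mixedSpace K) := (mixedEmbedding.integerLattice K : Set (mixedSpace K)) with hΛ
  have hne : Λ.Nonempty := ⟨0, zero_mem _⟩
  by_contra! hy
  set n := ⌊√|(discr K : ℝ)|⌋₊ with hn
  -- Along the segment from 0 to `y` the distance to the lattice takes each of the values `0, …, n`.
  have hex : ∀ k ∈ Finset.range (n + 1), ∃ x : mixedSpace K, Metric.infDist x Λ = k := by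
    intro k hk
    have hcont : ContinuousOn (fun t : ℝ => Metric.infDist (t • y) Λ) (Set.Icc 0 1) := by
      have := Metric.continuous_infDist_pt Λ
      fun_prop
    have h0 : Metric.infDist ((0 : ℝ) • y) Λ = 0 := by
      rw [zero_smul]
      exact Metric.infDist_zero_of_mem (zero_mem _)
    have hk' : (k : ℝ) ≤ Metric.infDist ((1 : ℝ) • y) Λ := by
      rw [one_smul]
      refine le_trans ?_ hy
      refine le_trans ?_ (Nat.floor_le (Real.sqrt_nonneg _))
      exact Nat.cast_le.mpr (Nat.lt_succ_iff.mp (Finset.mem_range.mp hk))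
    obtain ⟨t, -, ht⟩ := intermediate_value_Icc zero_le_one hcont
      (show (k : ℝ) ∈ Set.Icc _ _ from ⟨by rw [h0]; positivity, hk'⟩)
    exact ⟨_, ht⟩
  choose! p hp using hex
  set S : Set (mixedSpace K) := ⋃ k ∈ Finset.range (n + 1), Metric.ball (p k) (1 / 2) with hS
  -- The distance to `Λ` is periodic and 1-Lipschitz, so translates of balls at different levels are
  -- disjoint; at equal levels a nonzero translation has length at least 1.
  have key : ∀ k ∈ Finset.range (n + 1), ∀ k' ∈ Finset.range (n + 1), ∀ l ∈ Λ,
      ∀ b ∈ Metric.ball (p k) (1 / 2), ∀ b' ∈ Metric.ball (p k') (1 / 2),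
        b' = l + b → k = k' ∧ l = 0 := by
    intro k hk k' hk' l hl b hb b' hb' hbb
    rw [mem_ball_iff_norm] at hb hb'
    have htrans (x : mixedSpace K) : Metric.infDist (l + x) Λ = Metric.infDist x Λ := by
      have h1 (l : mixedSpace K) (hl : l ∈ Λ) (x : mixedSpace K) :
          Metric.infDist (l + x) Λ ≤ Metric.infDist x Λ := by
        refine le_of_forall_gt fun r hr => ?_
        obtain ⟨z, hz, hlt⟩ := (Metric.infDist_lt_iff hne).mp hr
        exact (Metric.infDist_lt_iff hne).mpr ⟨l + z, add_mem hl hz, by rwa [dist_add_left]⟩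
      refine le_antisymm (h1 l hl x) ?_
      simpa using h1 (-l) (neg_mem hl) (l + x)
    have hdist : dist (p k') (l + p k) < 1 := by
      rw [dist_eq_norm]
      have : p k' - (l + p k) = (b - p k) - (b' - p k') := by rw [hbb]; abel
      rw [this]
      exact (norm_sub_le _ _).trans_lt (by linarith)
    have hkk : k = k' := by
      have h1 := Metric.infDist_le_infDist_add_dist (s := Λ) (x := p k') (y := l + p k)
      have h2 := Metric.infDist_le_infDist_add_dist (s := Λ) (x := l + p k) (y := p k')
      rw [dist_comm] at h2
      rw [htrans, hp k hk, hp k' hk'] at h1 h2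
      have h3 : (k : ℝ) < k' + 1 := by linarith
      have h4 : (k' : ℝ) < k + 1 := by linarith
      have h3 : k < k' + 1 := by exact_mod_cast h3
      have h4 : k' < k + 1 := by exact_mod_cast h4
      omega
    refine ⟨hkk, ?_⟩
    by_contra hl0
    have := one_le_norm_of_mem_integerLattice hl hl0
    subst hkk
    rw [dist_eq_norm] at hdist
    simp only [sub_add_cancel_right, norm_neg] at hdist
    linarith
  have hvol : volume (ZSpan.fundamentalDomain (latticeBasis K)) < volume S := by
    have hSvol : volume S = ∑ k ∈ Finset.range (n + 1), volume (Metric.ball (p k) (1 / 2)) := by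
      refine measure_biUnion_finset ?_ fun _ _ => measurableSet_ball
      intro k hk k' hk' hkk'
      refine Set.disjoint_left.mpr fun b hb hb' => hkk' ?_
      exact (key k hk k' hk' 0 (zero_mem _) b hb b hb' (zero_add b).symm).1
    have h2 : ((2 : ℝ≥0∞) ^ finrank ℚ K) ≠ 0 := by simp
    have h2' : ((2 : ℝ≥0∞) ^ finrank ℚ K) ≠ ⊤ := by simp
    rw [← ENNReal.mul_lt_mul_iff_left h2 h2', hSvol, Finset.sum_mul]
    simp_rw [volume_ball_half]
    refine (volume_latticeBasis_mul_two_pow_le K).trans_lt ?_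
    rw [Finset.sum_const, Finset.card_range, nsmul_eq_mul, mul_comm]
    refine (ENNReal.mul_lt_mul_iff_left ?_ ENNReal.coe_ne_top).mpr ?_
    · exact_mod_cast convexBodyLTFactor_ne_zero K
    · have h : NNReal.sqrt ‖discr K‖₊ < ((n + 1 : ℕ) : NNReal) := by
        rw [← NNReal.coe_lt_coe, coe_sqrt_nnnorm_discr]
        simpa using Nat.lt_floor_add_one (√|(discr K : ℝ)|)
      exact_mod_cast h
  have hspan : ∀ l : (Submodule.span ℤ (Set.range (latticeBasis K))).toAddSubgroup,
      (l : mixedSpace K) ∈ Λ := fun l => (mem_span_latticeBasis K).mp l.2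
  have : Countable (Submodule.span ℤ (Set.range (latticeBasis K))).toAddSubgroup := by
    change Countable (Submodule.span ℤ (Set.range (latticeBasis K)))
    infer_instance
  obtain ⟨l, l', hll, hdisj⟩ := exists_pair_mem_lattice_not_disjoint_vadd
    (ZSpan.isAddFundamentalDomain' (latticeBasis K) volume)
    (Finset.measurableSet_biUnion _ fun _ _ => measurableSet_ball).nullMeasurableSet hvol
  obtain ⟨z, ⟨b, hb, rfl⟩, ⟨b', hb', hbb⟩⟩ := Set.not_disjoint_iff.mp hdisj
  simp only [Set.mem_iUnion] at hb hb'
  obtain ⟨k, hk, hb⟩ := hb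
  obtain ⟨k', hk', hb'⟩ := hb'
  have hbb' : (l' : mixedSpace K) + b' = (l : mixedSpace K) + b := hbb
  refine hll (sub_eq_zero.mp ?_)
  refine Subtype.ext (key k hk k' hk' _ (hspan (l - l')) b hb b' hb' ?_).2
  rw [AddSubgroup.coe_sub, sub_add_eq_add_sub, ← hbb']
  abel

/-- Every element of `K` is close to an element of `𝓞 K` at all infinite places. -/
theorem exists_ringOfIntegers_sub_lt (c : K) :
    ∃ b : 𝓞 K, ∀ w : InfinitePlace K, w (c - b) < √|(discr K : ℝ)| := by
  classical
  obtain ⟨x, hx, hlt⟩ := (Metric.infDist_lt_iff ⟨0, zero_mem _⟩).mp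
    (infDist_integerLattice_lt (mixedEmbedding K c))
  obtain ⟨b, rfl⟩ := LinearMap.mem_range.mp hx
  refine ⟨b, fun w => lt_of_le_of_lt ?_ hlt⟩
  rw [dist_eq_norm, ← normAtPlace_apply, map_sub]
  exact normAtPlace_le_norm _ w

end

end NumberField

/-! ### Direct sums from triangular coordinates. -/

/-- Submodules that are triangular for a jointly injective family of additive maps form an internal
direct sum. -/
theorem DirectSum.isInternal_of_triangular {R L G : Type*} [Ring R] [AddCommGroup L] [Module R L]
    [AddCommGroup G] {N : ℕ} (φ : Fin N → L →+ G) (hφ : ∀ x, (∀ i, φ i x = 0) → x = 0)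
    (M : Fin N → Submodule R L)
    (hgt : ∀ i, ∀ x ∈ M i, ∀ j, i < j → φ j x = 0)
    (hinj : ∀ i, ∀ x ∈ M i, φ i x = 0 → x = 0)
    (hsurj : ∀ i x, (∀ j, i < j → φ j x = 0) → ∃ y ∈ M i, φ i y = φ i x) :
    DirectSum.IsInternal M := by
  classical
  constructor
  · rw [injective_iff_map_eq_zero]
    intro x hx
    by_contra hne
    have hs : (Finset.univ.filter fun i => x i ≠ 0).Nonempty := by
      by_contra hs
      rw [Finset.not_nonempty_iff_eq_empty, Finset.filter_eq_empty_iff] at hs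
      exact hne (DFinsupp.ext fun i => not_not.mp (hs (Finset.mem_univ i)))
    -- At the largest index with a nonzero component, `φ i` sees only that component of the
    -- vanishing sum.
    set i := (Finset.univ.filter fun i => x i ≠ 0).max' hs with hi
    have hxi : x i ≠ 0 := (Finset.mem_filter.mp (Finset.max'_mem _ hs)).2
    have hsum : ∑ j, (x j : L) = 0 := by
      rw [← hx, DirectSum.coeAddMonoidHom_eq_dfinsuppSum]
      rw [DFinsupp.sum_eq_sum_fintype _ fun _ => rfl]
      rfl
    refine hxi (Subtype.ext (hinj i _ (x i).2 ?_))
    have h2 := congrArg (φ i) hsum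
    rw [map_sum, map_zero, Finset.sum_eq_single i] at h2
    · exact h2
    · intro j _ hj
      rcases lt_or_gt_of_ne hj with hj | hj
      · exact hgt j _ (x j).2 i hj
      · have : x j = 0 := by
          by_contra h
          exact hj.not_ge (Finset.le_max' _ _ (Finset.mem_filter.mpr ⟨Finset.mem_univ j, h⟩))
        simp [this]
    · simp
  -- Induction on the filtration: subtract an element of the top summand to kill the top coordinate.
  · have key : ∀ k ≤ N, ∀ x : L, (∀ j : Fin N, k ≤ j → φ j x = 0) → x ∈ ⨆ i, M i := by
      intro k
      induction k with
      | zero =>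
        intro _ x hx
        rw [hφ x fun i => hx i (Nat.zero_le _)]
        exact zero_mem _
      | succ k ih =>
        intro hk x hx
        obtain ⟨y, hy, hyx⟩ := hsurj ⟨k, hk⟩ x fun j hj => hx j hj
        rw [← sub_add_cancel x y]
        refine add_mem (ih (by omega) _ fun j hj => ?_) (Submodule.mem_iSup_of_mem _ hy)
        rw [map_sub]
        rcases hj.eq_or_lt with h | h
        · rw [show j = ⟨k, hk⟩ from Fin.ext h.symm, hyx, sub_self]
        · rw [hx j h, hgt _ y hy j h, sub_self]
    intro x
    have hx := key N le_rfl x fun j hj => absurd j.2 (not_lt.mpr hj)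
    rw [← DirectSum.range_coeLinearMap] at hx
    exact hx

/-! ### Construction of one summand and its small element. -/

namespace NumberField

open NumberField InfinitePlace mixedEmbedding Module

variable {K : Type*} [Field K]

/-- A linear map with integral values factors through the ring of integers. -/
theorem exists_lift_ringOfIntegers {M : Type*} [AddCommGroup M] [Module (𝓞 K) M]
    (f : M →ₗ[𝓞 K] K) (hf : ∀ x, ∃ a : 𝓞 K, (a : K) = f x) :
    ∃ g : M →ₗ[𝓞 K] 𝓞 K, ∀ x, (g x : K) = f x := by
  choose g hg using hf
  refine ⟨{ toFun := g, map_add' := fun x y => ?_, map_smul' := fun c x => ?_ }, hg⟩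
  · refine RingOfIntegers.ext ?_
    rw [hg, map_add, ← hg, ← hg]
    exact (map_add (algebraMap (𝓞 K) K) _ _).symm
  · refine RingOfIntegers.ext ?_
    rw [hg, map_smul, ← hg, Algebra.smul_def]
    exact (map_mul (algebraMap (𝓞 K) K) _ _).symm

variable [NumberField K]

theorem projective_ideal (A : Ideal (𝓞 K)) : Module.Projective (𝓞 K) A := by
  have : Module.FinitePresentation (𝓞 K) A := Module.finitePresentation_of_finite _ _
  exact Module.Flat.projective_of_finitePresentation

theorem finrank_ideal (A : Ideal (𝓞 K)) {a : 𝓞 K} (ha : a ∈ A) (ha0 : a ≠ 0) :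
    finrank (𝓞 K) A = 1 := by
  refine le_antisymm ?_ ?_
  · rw [← finrank_self (𝓞 K)]
    exact LinearMap.finrank_le_finrank_of_injective A.injective_subtype
  · rw [← finrank_self (𝓞 K)]
    refine LinearMap.finrank_le_finrank_of_injective
      (f := LinearMap.toSpanSingleton (𝓞 K) A ⟨a, ha⟩) fun x y hxy => ?_
    have := congrArg Subtype.val hxy
    simpa [ha0] using this

theorem card_quotient_span_mul_absNorm (A : Ideal (𝓞 K)) {a : 𝓞 K} (ha : a ∈ A) :
    Nat.card (A ⧸ Submodule.span (𝓞 K) {(⟨a, ha⟩ : A)}) * Ideal.absNorm A =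
      Ideal.absNorm (Ideal.span {a}) := by
  have hle : (Ideal.span {a}).toAddSubgroup ≤ A.toAddSubgroup :=
    (Ideal.span_singleton_le_iff_mem A).mpr ha
  have h := AddSubgroup.relIndex_mul_index hle
  have h1 (B : Ideal (𝓞 K)) : B.toAddSubgroup.index = Ideal.absNorm B := rfl
  rw [h1, h1] at h
  rw [← h]
  congr 1
  rw [AddSubgroup.relIndex]
  have h2 : (Submodule.span (𝓞 K) {(⟨a, ha⟩ : A)}).toAddSubgroup =
      (Ideal.span {a}).toAddSubgroup.addSubgroupOf A.toAddSubgroup := by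
    ext x
    change x ∈ Submodule.span (𝓞 K) {(⟨a, ha⟩ : A)} ↔ (x : 𝓞 K) ∈ Ideal.span {a}
    rw [Ideal.mem_span_singleton', Submodule.mem_span_singleton]
    exact exists_congr fun c => (Subtype.ext_iff (a1 := c • (⟨a, ha⟩ : A)) (a2 := x))
  exact congrArg AddSubgroup.index h2

/-- Given coordinates `φ j` with respect to elements `e j` of `L`, there is a rank one submodule of
the `i`-th step of the associated filtration which maps isomorphically to the `i`-th graded piece
and which contains, with small index, an element with small coordinates. -/
theorem exists_small_lift {L : Type*} [AddCommGroup L] [Module (𝓞 K) L] [Module.Finite (𝓞 K) L]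
    {N : ℕ} (φ : Fin N → L →ₗ[𝓞 K] K) (e : Fin N → L)
    (he : ∀ i j, φ i (e j) = if i = j then 1 else 0) (i : Fin N) :
    ∃ (M : Submodule (𝓞 K) L) (f : M),
      (∀ x ∈ M, ∀ j, i < j → φ j x = 0) ∧
      (∀ x ∈ M, φ i x = 0 → x = 0) ∧
      (∀ x, (∀ j, i < j → φ j x = 0) → ∃ y ∈ M, φ i y = φ i x) ∧
      finrank (𝓞 K) M = 1 ∧
      Finite (M ⧸ Submodule.span (𝓞 K) {f}) ∧
      (Nat.card (M ⧸ Submodule.span (𝓞 K) {f}) : ℝ) ≤ 2 * √|(discr K : ℝ)| ∧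
      ∀ j (w : InfinitePlace K), w (φ j f) ≤ 2 * |(discr K : ℝ)| := by
  classical
  let W : Submodule (𝓞 K) L := ⨅ j, ⨅ (_ : i < j), LinearMap.ker (φ j)
  have hW (x : L) : x ∈ W ↔ ∀ j, i < j → φ j x = 0 := by simp [W, Submodule.mem_iInf]
  have heW (j : Fin N) (hj : j ≤ i) : e j ∈ W := by
    rw [hW]
    intro k hk
    rw [he, if_neg (hj.trans_lt hk).ne']
  have hfg : (W.map (φ i)).FG := (IsNoetherian.noetherian W).map _
  -- A common denominator `n` turns the image of `W` into the integral ideal `A`; it lies in `A`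
  -- because `φ i (e i) = 1`.
  obtain ⟨n, hn, hint⟩ := FractionalIdeal.isFractional_of_fg (S := nonZeroDivisors (𝓞 K)) hfg
  have hn0 : n ≠ 0 := nonZeroDivisors.ne_zero hn
  have hnK : (n : K) ≠ 0 := RingOfIntegers.coe_ne_zero_iff.mpr hn0
  obtain ⟨g, hg⟩ := exists_lift_ringOfIntegers (n • (φ i ∘ₗ W.subtype)) fun x => by
    obtain ⟨a, ha⟩ := hint _ (Submodule.mem_map_of_mem x.2)
    exact ⟨a, ha⟩
  have hg' (x : W) : (g x : K) = n * φ i x := by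
    rw [hg, LinearMap.smul_apply, Algebra.smul_def]
    rfl
  set A : Ideal (𝓞 K) := LinearMap.range g with hA
  have hnA : n ∈ A := by
    refine ⟨⟨e i, heW i le_rfl⟩, RingOfIntegers.ext ?_⟩
    rw [hg', he, if_pos rfl, mul_one]
  obtain ⟨a, haA, ha0, haw, haN⟩ := exists_mem_ideal_small A n hn0 hnA
  have haK : (a : K) ≠ 0 := RingOfIntegers.coe_ne_zero_iff.mpr ha0
  have := projective_ideal A
  obtain ⟨s, hs⟩ := Module.projective_lifting_property g.rangeRestrict (LinearMap.id (M := A))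
    g.surjective_rangeRestrict
  have hs (t : A) : φ i (s t) = ((t : 𝓞 K) : K) / n := by
    rw [eq_div_iff hnK, mul_comm, ← hg']
    exact congrArg (fun t : A => ((t : 𝓞 K) : K)) (LinearMap.congr_fun hs t)
  set m := Nat.card (A ⧸ Submodule.span (𝓞 K) {(⟨a, haA⟩ : A)}) with hm
  have hcard := card_quotient_span_mul_absNorm A haA
  rw [← hm] at hcard
  have haN0 : Ideal.absNorm (Ideal.span {a}) ≠ 0 := by
    simpa [Ideal.absNorm_eq_zero_iff] using ha0
  have hm0 : m ≠ 0 := by rintro h; exact haN0 (by rw [← hcard, h, zero_mul])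
  have hAN0 : Ideal.absNorm A ≠ 0 := by rintro h; exact haN0 (by rw [← hcard, h, mul_zero])
  have hmle : (m : ℝ) ≤ 2 * √|(discr K : ℝ)| := by
    rw [← hcard, Nat.cast_mul] at haN
    exact le_of_mul_le_mul_right haN (by positivity)
  -- Multiplication by `m / a` is integral on `A` because `m`, the order of `A / (a)`, kills that
  -- quotient. It sends `a` to `m`.
  obtain ⟨q, hq⟩ := exists_lift_ringOfIntegers
      (LinearMap.mulLeft (𝓞 K) ((m : K) / a) ∘ₗ Algebra.linearMap (𝓞 K) K ∘ₗ A.subtype) fun t => by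
    have h : m • (Submodule.Quotient.mk t : A ⧸ Submodule.span (𝓞 K) {(⟨a, haA⟩ : A)}) = 0 :=
      card_nsmul_eq_zero'
    rw [← Submodule.Quotient.mk_smul, Submodule.Quotient.mk_eq_zero,
      Submodule.mem_span_singleton] at h
    obtain ⟨c, hc⟩ := h
    refine ⟨c, ?_⟩
    have hc' : algebraMap (𝓞 K) K (c * a) = algebraMap (𝓞 K) K (m • (t : 𝓞 K)) :=
      congrArg (fun t : A => algebraMap (𝓞 K) K t) hc
    rw [map_mul, map_nsmul, nsmul_eq_mul] at hc'
    change (c : K) = m / a * ((t : 𝓞 K) : K)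
    rw [div_mul_eq_mul_div, eq_div_iff haK, hc']
  have hqa : (q ⟨a, haA⟩ : K) = m := by
    rw [hq]
    exact div_mul_cancel₀ _ haK
  have hm0K : (m : K) ≠ 0 := Nat.cast_ne_zero.mpr hm0
  -- Rounding after division by `m`: subtracting `q t • b j • e j` from the section lowers the
  -- `j`-th coordinate at `a` by `m * b j`.
  choose b hb using fun j => exists_ringOfIntegers_sub_lt (φ j (s ⟨a, haA⟩) / (m : K))
  let s' : A →ₗ[𝓞 K] L :=
    W.subtype ∘ₗ s - ∑ j ∈ Finset.Iio i, LinearMap.toSpanSingleton (𝓞 K) L (b j • e j) ∘ₗ q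
  have hs' (t : A) : s' t = s t - ∑ j ∈ Finset.Iio i, q t • b j • e j := by
    simp [s', LinearMap.sum_apply]
  have hφs' (k : Fin N) (t : A) :
      φ k (s' t) = φ k (s t) - if k < i then (q t : K) * b k else 0 := by
    rw [hs', map_sub, map_sum]
    congr 1
    simp_rw [map_smul, he, Algebra.smul_def]
    simp [mul_comm]
  have hφi (t : A) : φ i (s' t) = ((t : 𝓞 K) : K) / n := by
    rw [hφs', if_neg (lt_irrefl i), sub_zero, hs]
  have hs'inj : Function.Injective s' := by
    intro t u htu
    have h := congrArg (φ i) htu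
    rw [hφi, hφi, div_left_inj' hnK] at h
    exact Subtype.ext (RingOfIntegers.coe_injective h)
  have hφgt (t : A) (j : Fin N) (hj : i < j) : φ j (s' t) = 0 := by
    rw [hφs', if_neg hj.not_gt, sub_zero]
    exact (hW _).mp (s t).2 j hj
  let E : A ≃ₗ[𝓞 K] LinearMap.range s' := LinearEquiv.ofInjective s' hs'inj
  let Q : (A ⧸ Submodule.span (𝓞 K) {(⟨a, haA⟩ : A)}) ≃ₗ[𝓞 K]
      (LinearMap.range s' ⧸ Submodule.span (𝓞 K) {E ⟨a, haA⟩}) :=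
    Submodule.Quotient.equiv _ _ E (by rw [Submodule.map_span, Set.image_singleton]; rfl)
  have hS := one_le_sqrt_abs_discr K
  have hD : √|(discr K : ℝ)| * √|(discr K : ℝ)| = |(discr K : ℝ)| :=
    Real.mul_self_sqrt (abs_nonneg _)
  refine ⟨LinearMap.range s', E ⟨a, haA⟩, ?_, ?_, ?_, ?_, ?_, ?_, ?_⟩
  · rintro _ ⟨t, rfl⟩ j hj
    exact hφgt t j hj
  · rintro _ ⟨t, rfl⟩ ht
    rw [hφi, div_eq_zero_iff, or_iff_left hnK] at ht
    rw [show t = 0 from Subtype.ext (RingOfIntegers.coe_eq_zero_iff.mp ht), map_zero]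
  · intro x hx
    refine ⟨_, ⟨⟨g ⟨x, (hW x).mpr hx⟩, ⟨_, rfl⟩⟩, rfl⟩, ?_⟩
    rw [hφi, hg', mul_div_cancel_left₀ _ hnK]
  · rw [← E.finrank_eq, finrank_ideal A haA ha0]
  · have : Finite (A ⧸ Submodule.span (𝓞 K) {(⟨a, haA⟩ : A)}) :=
      Nat.finite_of_card_ne_zero hm0
    exact Finite.of_equiv _ Q.toEquiv
  · rwa [← Nat.card_congr Q.toEquiv]
  · intro j w
    change w (φ j (s' ⟨a, haA⟩)) ≤ _
    rcases lt_trichotomy j i with hj | rfl | hj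
    · rw [hφs', if_pos hj, hqa]
      have h : φ j (s ⟨a, haA⟩) - m * b j = m * (φ j (s ⟨a, haA⟩) / (m : K) - b j) := by
        field_simp
      rw [h, map_mul, ← hD]
      have hwm : w (m : K) = m := by simp
      rw [hwm]
      calc _ ≤ (2 * √|(discr K : ℝ)|) * √|(discr K : ℝ)| := by
            gcongr
            exact (hb j w).le
        _ = _ := by ring
    · rw [hφi, map_div₀, div_le_iff₀ (InfinitePlace.pos_iff.mpr hnK)]
      refine (haw w).trans ?_
      gcongr
      exact (le_mul_of_one_le_left (by positivity) hS).trans_eq hD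
    · rw [hφgt _ j hj, map_zero]
      positivity

end NumberField

/-! ### Norm estimates and comparison of constants. -/

namespace HermitianLattice

open NumberField Module

variable {F : Type*} [Field F] [NumberField F] {L : Type*} [AddCommGroup L] [Module (𝓞 F) L]

theorem SesqForm.quad_nonneg {h : SesqForm F L} (hpos : h.IsPosDef) (x : VR F L) : 0 ≤ h.quad x :=
  Finset.sum_nonneg fun σ _ => hpos.1 x σ

variable (F) in
/-- The real part of the trace `F_ℝ → ℂ`. -/
noncomputable def reTrace : FR F →+ ℝ where
  toFun a := ∑ σ : F →+* ℂ, ((a : (F →+* ℂ) → ℂ) σ).re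
  map_zero' := by simp
  map_add' a b := by simp [Finset.sum_add_distrib]

theorem SesqForm.quad_eq_reTrace (h : SesqForm F L) (x : VR F L) :
    h.quad x = reTrace F (h x x) := rfl

/-- Cauchy–Schwarz, obtained by expanding the nonnegative double sum of `h.quad (x j - x k)`. -/
theorem SesqForm.quad_sum_le {h : SesqForm F L} (hpos : h.IsPosDef) {ι : Type*} (s : Finset ι)
    (x : ι → VR F L) : h.quad (∑ j ∈ s, x j) ≤ s.card * ∑ j ∈ s, h.quad (x j) := by
  have h0 : 0 ≤ ∑ j ∈ s, ∑ k ∈ s, h.quad (x j - x k) :=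
    Finset.sum_nonneg fun _ _ => Finset.sum_nonneg fun _ _ => quad_nonneg hpos _
  have h1 : ∑ j ∈ s, ∑ k ∈ s, reTrace F (h (x j) (x k)) = h.quad (∑ j ∈ s, x j) := by
    simp_rw [quad_eq_reTrace, map_sum h, LinearMap.sum_apply, map_sum]
  have h2 : ∑ j ∈ s, ∑ k ∈ s, reTrace F (h (x k) (x j)) = h.quad (∑ j ∈ s, x j) := by
    rw [Finset.sum_comm, h1]
  simp_rw [quad_eq_reTrace, map_sub, LinearMap.sub_apply, map_sub, Finset.sum_sub_distrib] at h0
  rw [h1, h2] at h0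
  simp only [Finset.sum_const, nsmul_eq_mul, ← Finset.mul_sum, ← quad_eq_reTrace] at h0
  linarith

theorem SesqForm.quad_toFR_smul_le {h : SesqForm F L} (hpos : h.IsPosDef) (c : F) {R : ℝ}
    (hc : ∀ w : InfinitePlace F, w c ≤ R) (x : VR F L) :
    h.quad (toFR F c • x) ≤ R ^ 2 * h.quad x := by
  rw [quad, quad, Finset.mul_sum]
  refine Finset.sum_le_sum fun σ _ => ?_
  have h1 : (h.comp σ (toFR F c • x) (toFR F c • x)).re = ‖σ c‖ ^ 2 * (h.comp σ x x).re := by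
    have h2 : h.comp σ (toFR F c • x) (toFR F c • x) =
        (starRingEnd ℂ (σ c)) * (σ c * h.comp σ x x) := by
      simp only [comp, map_smul, LinearMap.smul_apply, map_smulₛₗ]
      rfl
    rw [h2, ← mul_assoc, mul_comm (starRingEnd ℂ (σ c)), Complex.mul_conj, Complex.re_ofReal_mul,
      Complex.normSq_eq_norm_sq]
  rw [h1]
  have h3 : ‖σ c‖ ≤ R := hc (InfinitePlace.mk σ)
  have := hpos.1 x σ
  gcongr

theorem SesqForm.norm_sum_smul_le {h : SesqForm F L} (hpos : h.IsPosDef) {ι : Type*}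
    (s : Finset ι) (c : ι → F) (x : ι → VR F L) {R : ℝ} (hR : 0 ≤ R)
    (hc : ∀ j ∈ s, ∀ w : InfinitePlace F, w (c j) ≤ R) (hx : ∀ j ∈ s, h.norm (x j) ≤ 1) :
    h.norm (∑ j ∈ s, toFR F (c j) • x j) ≤ s.card * R := by
  refine Real.sqrt_le_iff.mpr ⟨by positivity, (quad_sum_le hpos s _).trans ?_⟩
  have h1 : ∑ j ∈ s, h.quad (toFR F (c j) • x j) ≤ ∑ j ∈ s, R ^ 2 := by
    refine Finset.sum_le_sum fun j hj => (quad_toFR_smul_le hpos _ (hc j hj) _).trans ?_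
    have : h.quad (x j) ≤ 1 := Real.sqrt_le_one.mp (hx j hj)
    exact mul_le_of_le_one_right (by positivity) this
  rw [Finset.sum_const, nsmul_eq_mul] at h1
  calc _ ≤ (s.card : ℝ) * (s.card * R ^ 2) := by gcongr
    _ = _ := by ring

variable (F L) in
/-- The canonical map `L → V` as a linear map. -/
noncomputable def toVLinear : L →ₗ[𝓞 F] V F L := TensorProduct.mk (𝓞 F) F L 1

/-- A free module is flat, so tensoring with it preserves the injectivity of `𝓞 F → F`. -/
theorem toVLinear_injective [Module.Free (𝓞 F) L] : Function.Injective (toVLinear F L) := by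
  have h : (toVLinear F L) = (LinearMap.rTensor L (Algebra.linearMap (𝓞 F) F)) ∘ₗ
      (TensorProduct.lid (𝓞 F) L).symm.toLinearMap := by
    ext x
    simp [toVLinear]
  rw [h]
  exact (Module.Flat.rTensor_preserves_injective_linearMap _
    (RingOfIntegers.coe_injective)).comp (TensorProduct.lid (𝓞 F) L).symm.injective

variable (F) in
-- The right side equals `d ^ (d / 2) * |D|`, and `d ^ (d / 2) ≥ 2` once `d ≥ 2`.
theorem two_mul_abs_discr_le_C₃_pow (hF : finrank ℚ F ≠ 1) :
    2 * |(discr F : ℝ)| ≤ C₃ F ^ finrank ℚ F := by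
  have hd : 2 ≤ finrank ℚ F := by
    have : 0 < finrank ℚ F := finrank_pos
    omega
  have hd' : (2 : ℝ) ≤ finrank ℚ F := by exact_mod_cast hd
  have hsq : 2 ≤ √(finrank ℚ F : ℝ) ^ finrank ℚ F := by
    calc (2 : ℝ) ≤ √(finrank ℚ F : ℝ) ^ 2 := by rwa [Real.sq_sqrt (by positivity)]
      _ ≤ _ := pow_le_pow_right₀ (Real.one_le_sqrt.mpr (by linarith)) hd
  rw [C₃, mul_pow, one_div, Real.rpow_inv_natCast_pow (by positivity) (by omega)]
  gcongr

variable (F) in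
theorem two_mul_abs_discr_le (hF : finrank ℚ F ≠ 1) :
    2 * |(discr F : ℝ)| ≤ C₁ F * C₂ F * C₃ F ^ finrank ℚ F := by
  have hd : (2 : ℝ) ≤ finrank ℚ F := by
    have : 0 < finrank ℚ F := finrank_pos
    exact_mod_cast (show 2 ≤ finrank ℚ F by omega)
  have hD := one_le_abs_discr F
  have hDd : 1 ≤ |(discr F : ℝ)| ^ (1 / (finrank ℚ F : ℝ)) :=
    Real.one_le_rpow hD (by positivity)
  have hC3 := two_mul_abs_discr_le_C₃_pow F hF
  refine hC3.trans (le_mul_of_one_le_left (by linarith) ?_)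
  refine one_le_mul_of_one_le_of_one_le (one_le_sqrt_abs_discr F) ?_
  rw [C₂]
  exact one_le_mul_of_one_le_of_one_le (by linarith) hDd

end HermitianLattice

/-! ### Assembly. -/

open HermitianLattice in
theorem proposition4p6
    {F : Type*} [Field F] [NumberField F] (hF : Module.finrank ℚ F ≠ 1)
    {L : Type*} [AddCommGroup L] [Module (𝓞 F) L] [Module.Free (𝓞 F) L] [Module.Finite (𝓞 F) L]
    (N : ℕ) (hN : Module.finrank (𝓞 F) L = N)
    (h : SesqForm F L) (hherm : h.IsHermitian) (hpos : h.IsPosDef)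
    (e : Fin N → L)
    (he_span : Submodule.span F (Set.range fun i => toV F (e i)) = ⊤)
    (he_norm : ∀ i, h.norm (toVR F (e i)) ≤ 1) :
    ∃ (M : Fin N → Submodule (𝓞 F) L) (f : ∀ i, M i),
      DirectSum.IsInternal M ∧
      ∀ i : Fin N,
        Module.finrank (𝓞 F) (M i) = 1 ∧
        Finite (M i ⧸ Submodule.span (𝓞 F) {f i}) ∧
        (Nat.card (M i ⧸ Submodule.span (𝓞 F) {f i}) : ℝ)
          ≤ C₁ F * C₃ F ^ Module.finrank ℚ F ∧
        h.norm (toVR F (f i : L))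
          ≤ ((i : ℕ) + 1 : ℝ) * C₁ F * C₂ F * C₃ F ^ Module.finrank ℚ F := by
  have hC3 : 2 ≤ C₃ F ^ Module.finrank ℚ F := by
    linarith [NumberField.one_le_abs_discr F, two_mul_abs_discr_le_C₃_pow F hF]
  have hCD := two_mul_abs_discr_le F hF
  let b : Module.Basis (Fin N) F (V F L) := basisOfTopLeSpanOfCardEqFinrank
    (fun i => toV F (e i)) he_span.ge
    (by rw [Fintype.card_fin, Module.finrank_baseChange, hN])
  have hb (j : Fin N) : b j = toVLinear F L (e j) := by
    simp only [b, coe_basisOfTopLeSpanOfCardEqFinrank]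
    rfl
  let φ : Fin N → L →ₗ[𝓞 F] F := fun i => (b.coord i).restrictScalars (𝓞 F) ∘ₗ toVLinear F L
  have hφ (i : Fin N) (x : L) : φ i x = b.repr (toVLinear F L x) i := rfl
  have hφe (i j : Fin N) : φ i (e j) = if i = j then 1 else 0 := by
    rw [hφ, ← hb, Module.Basis.repr_self, Finsupp.single_apply]
    simp only [eq_comm]
  choose M f hgt hinj hsurj hrank hfin hcard hw using NumberField.exists_small_lift φ e hφe
  refine ⟨M, f, ?_, fun i => ⟨hrank i, hfin i, (hcard i).trans ?_, ?_⟩⟩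
  · refine DirectSum.isInternal_of_triangular (fun i => (φ i).toAddMonoidHom) (fun x hx => ?_) M
      hgt hinj hsurj
    refine toVLinear_injective (F := F) ?_
    rw [map_zero]
    exact b.repr.map_eq_zero_iff.mp (Finsupp.ext hx)
  · rw [mul_comm]
    exact mul_le_mul_of_nonneg_left hC3 (Real.sqrt_nonneg _)
  -- Coordinates beyond `i` vanish, leaving `i + 1` terms because `Fin` counts from 0.
  · have hf : toVR F (f i : L) = ∑ j ∈ Finset.Iic i, toFR F (φ j (f i)) • toVR F (e j) := by
      have h1 : toV F (f i : L) = ∑ j ∈ Finset.Iic i, φ j (f i) • toV F (e j) := by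
        change toVLinear F L (f i) = _
        rw [← b.sum_repr (toVLinear F L (f i))]
        symm
        refine (Finset.sum_congr rfl fun j _ => ?_).trans
          (Finset.sum_subset (Finset.subset_univ (Finset.Iic i)) fun j _ hj => ?_)
        · rw [hb, hφ]
          rfl
        · rw [← hφ, hgt i _ (f i).2 j (by simpa using hj), zero_smul]
      rw [toVR, h1, TensorProduct.tmul_sum]
      refine Finset.sum_congr rfl fun j _ => ?_
      rw [toVR, TensorProduct.tmul_smul, TensorProduct.smul_tmul', TensorProduct.smul_tmul',
        Algebra.smul_def, smul_eq_mul]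
      rfl
    rw [hf]
    refine (SesqForm.norm_sum_smul_le hpos _ _ _ (by positivity) (fun j _ w => hw i j w)
      fun j _ => he_norm j).trans ?_
    rw [Fin.card_Iic, mul_assoc, mul_assoc, ← mul_assoc (C₁ F)]
    push_cast
    gcongr
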